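/- Let $\mathcal D=\{z\in\mathbb C:|z|<1\}$ carry the hyperbolic metric $(1-|z|^2)^{-2}(dx^2+dy^2)$, with area element $d\mathrm{vol}_H=(1-|z|^2)^{-2}\,dx\,dy$, and let $\Omega_{z_0,R}=\{z\in\mathcal D:|(z-z_0)/(1-\bar z_0z)|\le\tanh R\}$ be the hyperbolic disk of center $z_0$ and radius $R$. Let $M_D$ be the set of disk Möbius transformations $m(z)=e^{i\theta}\frac{z-a}{1-\bar az}$, $a\in\mathcal D$, $\theta\in[0,2\pi)$. A disk-type surface is a surface $\mathcal M$ with a smooth Riemannian metric $g$, of total area $1$, that admits a uniformization, i.e. a conformal diffeomorphism $\phi:\mathcal M\to\mathcal D$. If $\phi_*g=\tilde\mu(z)(dx^2+dy^2)$, then $\mu(z)=(1-|z|^2)^2\tilde\mu(z)$ is called the conformal factor of $\mathcal M$ under $\phi$; also write $\mu$ for the probability measure $\mu\,d\mathrm{vol}_H$ on $\mathcal D$. For conformal factors $\mu,\nu$ of two disk-type surfaces $\mathcal M,\mathcal N$ (under uniformizations $\phi,\psi$) and $R>0$, put $$d^R_{\mu,\nu}(z_0,w_0)=\inf_{m\in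 M_D,\ m(z_0)=w_0}\int_{\Omega_{z_0,R}}|\mu(z)-\nu(m(z))|\,d\mathrm{vol}_H(z)\qquad(z_0,w_0\in\mathcal D),$$ $$\mathbf d^R(\mathcal M,\mathcal N)=\inf_{\pi\in\Pi(\mu,\nu)}\int_{\mathcal D\times\mathcal D}d^R_{\mu,\nu}(z,w)\,d\pi(z,w),$$ where $\Pi(\mu,\nu)$ is the set of measures on $\mathcal D\times\mathcal D$ with marginals $\mu$ and $\nu$. For $\varrho>0$, a disk-type surface $\mathcal M$ is called singly $\varrho$-H-fittable if for every conformal factor $\mu$ of $\mathcal M$, all $R>\varrho$ and all $z_0\in\mathcal D$, the identity is the only $m\in M_D$ with $\int_{\Omega_{z_0,R}}|\mu(z)-\mu(m(z))|\,d\mathrm{vol}_H(z)=0$. Theorem. Let $\varrho>0$ and let $\mathcal M,\mathcal N$ be disk-type surfaces that are both singly $\varrho$-H-fittable, with conformal factors $\mu,\nu$ under uniformizations $\phi,\psi$. If $\mathbf d^R(\mathcal M,\mathcal N)=0$ for some $R>\varrho$ (computed with $\mu,\nu$), then there is $m\in M_D$ with $\mu=\nu\circ m$ on $\mathcal D$,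 and $m$ is a global isometry between $\mathcal M$ and $\mathcal N$: the map $\psi^{-1}\circ m\circ\phi:\mathcal M\to\mathcal N$ is a diffeomorphism that pulls the metric of $\mathcal N$ back to the metric of $\mathcal M$. -/

import Mathlib

open scoped Manifold ContDiff ComplexConjugate
open MeasureTheory

/-- The open unit disk `D` in the complex plane. -/
def unitDisk : Set ℂ := {z | ‖z‖ < 1}

/-- The disk-preserving Möbius transformations
`z ↦ exp (i θ) (z - a) / (1 - conj a * z)` with `a ∈ D` and `θ ∈ [0, 2π)`. -/
def diskMobius : Set (ℂ → ℂ) :=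
  {m | ∃ a ∈ unitDisk, ∃ θ ∈ Set.Ico (0 : ℝ) (2 * Real.pi),
    m = fun z => Complex.exp (θ * Complex.I) * ((z - a) / (1 - conj a * z))}

/-- The hyperbolic area measure `(1 - |z|²)⁻² dx dy`, carried by the unit disk. -/
noncomputable def volH : Measure ℂ :=
  (volume.restrict unitDisk).withDensity fun z => ENNReal.ofReal (((1 - ‖z‖ ^ 2) ^ 2)⁻¹)

/-- The closed hyperbolic disk of centre `z₀` and radius `R`, for the hyperbolic metric
`(1 - |z|²)⁻² (dx² + dy²)`: the image of `{|z| ≤ tanh R}` under a disk Möbius transformation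
that maps `0` to `z₀`. -/
def hypDisk (z₀ : ℂ) (R : ℝ) : Set ℂ :=
  {z ∈ unitDisk | ‖(z - z₀) / (1 - conj z₀ * z)‖ ≤ Real.tanh R}

/-- `∫_{Ω(z₀, R)} |μ(z) - ν(m(z))| dvol_H(z)`, as an element of `[0, ∞]`. -/
noncomputable def patchDiscrepancy (R : ℝ) (μ ν : ℂ → ℝ) (m : ℂ → ℂ) (z₀ : ℂ) : ENNReal :=
  ∫⁻ z in hypDisk z₀ R, ENNReal.ofReal |μ z - ν (m z)| ∂volH

/-- The local dissimilarity `d^R_{μ,ν}(z₀, w₀)`: the infimum of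
`∫_{Ω(z₀, R)} |μ(z) - ν(m(z))| dvol_H(z)` over the disk Möbius transformations `m` with
`m(z₀) = w₀`. -/
noncomputable def localDist (R : ℝ) (μ ν : ℂ → ℝ) (z₀ w₀ : ℂ) : ENNReal :=
  ⨅ (m : ℂ → ℂ) (_ : m ∈ diskMobius) (_ : m z₀ = w₀), patchDiscrepancy R μ ν m z₀

/-- The measure with hyperbolic density `μ`. -/
noncomputable def densityMeasure (μ : ℂ → ℝ) : Measure ℂ :=
  volH.withDensity fun z => ENNReal.ofReal (μ z)

/-- Transport plans `π` whose marginals have the hyperbolic densities `μ` and `ν`. -/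
def transportPlans (μ ν : ℂ → ℝ) : Set (Measure (ℂ × ℂ)) :=
  {π | π.map Prod.fst = densityMeasure μ ∧ π.map Prod.snd = densityMeasure ν}

/-- The transportation cost `T^R_d(μ, ν)`: the infimum over the transport plans `π` of
`∫_{D × D} d^R_{μ,ν}(z, w) dπ(z, w)`. -/
noncomputable def transportCost (R : ℝ) (μ ν : ℂ → ℝ) : ENNReal :=
  ⨅ (π : Measure (ℂ × ℂ)) (_ : π ∈ transportPlans μ ν),
    ∫⁻ p in unitDisk ×ˢ unitDisk, localDist R μ ν p.1 p.2 ∂π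

/-- Smooth Riemannian metrics on a smooth surface (without boundary). -/
abbrev SurfaceMetric (M : Type*) [TopologicalSpace M]
    [ChartedSpace (EuclideanSpace ℝ (Fin 2)) M] [IsManifold (𝓡 2) ∞ M] :=
  Bundle.ContMDiffRiemannianMetric (𝓡 2) ∞ (EuclideanSpace ℝ (Fin 2))
    (fun x : M => TangentSpace (𝓡 2) x)

section Surface

variable {M : Type*} [TopologicalSpace M] [ChartedSpace (EuclideanSpace ℝ (Fin 2)) M]
  [IsManifold (𝓡 2) ∞ M]

/-- The metric `g` in the coordinates given by a parametrization `f`, at the point `z`, applied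
to the tangent vectors `a`, `b`. -/
noncomputable def metricInCoord (g : SurfaceMetric M) (f : ℂ → M) (z a b : ℂ) : ℝ :=
  g.inner (f z) (mfderiv 𝓘(ℝ, ℂ) (𝓡 2) f z a) (mfderiv 𝓘(ℝ, ℂ) (𝓡 2) f z b)

/-- A uniformization of the surface `(M, g)`: a conformal diffeomorphism `φ` from `M` onto the
open unit disk (`invFun` is its inverse, relevant on the disk only). Conformality says that the
push-forward of `g` is at each point a multiple of the Euclidean metric. A surface is of disk type
when it has a uniformization. -/
structure Uniformization (g : SurfaceMetric M) where
  /-- the map `φ` -/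
  toFun : M → ℂ
  /-- its inverse -/
  invFun : ℂ → M
  mem_unitDisk : ∀ x, toFun x ∈ unitDisk
  left_inv : ∀ x, invFun (toFun x) = x
  right_inv : ∀ z ∈ unitDisk, toFun (invFun z) = z
  contMDiff_toFun : ContMDiff (𝓡 2) 𝓘(ℝ, ℂ) ∞ toFun
  contMDiffOn_invFun : ContMDiffOn 𝓘(ℝ, ℂ) (𝓡 2) ∞ invFun unitDisk
  conformal : ∀ z ∈ unitDisk, ∃ c : ℝ, ∀ a b : ℂ,
    metricInCoord g invFun z a b = c * inner ℝ a b

/-- The Euclidean density of the push-forward `φ_* g`, that is, the factor by which `φ_* g`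
differs from the Euclidean metric. -/
noncomputable def Uniformization.euclideanFactor {g : SurfaceMetric M} (φ : Uniformization g)
    (z : ℂ) : ℝ :=
  metricInCoord g φ.invFun z 1 1

/-- The conformal factor of `(M, g)` under `φ`, that is, the hyperbolic density of `φ_* g`. -/
noncomputable def Uniformization.conformalFactor {g : SurfaceMetric M} (φ : Uniformization g)
    (z : ℂ) : ℝ :=
  (1 - ‖z‖ ^ 2) ^ 2 * φ.euclideanFactor z

/-- The total area of `(M, g)`, computed in the coordinates given by `φ`. -/
noncomputable def Uniformization.area {g : SurfaceMetric M} (φ : Uniformization g) : ENNReal :=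
  ∫⁻ z in unitDisk, ENNReal.ofReal (φ.euclideanFactor z)

/-- `(M, g)` is singly `ϱ`-H-fittable: for every uniformization, with conformal factor `μ`, every
`R > ϱ` and every `z₀ ∈ D`, the only disk Möbius transformation `m` with
`∫_{Ω(z₀, R)} |μ(z) - μ(m(z))| dvol_H(z) = 0` is the identity of `D`. -/
def IsSinglyFittable (g : SurfaceMetric M) (ϱ : ℝ) : Prop :=
  ∀ φ : Uniformization g, ∀ R : ℝ, ϱ < R → ∀ z₀ ∈ unitDisk, ∀ m ∈ diskMobius,
    patchDiscrepancy R φ.conformalFactor φ.conformalFactor m z₀ = 0 → ∀ z ∈ unitDisk, m z = z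

end Surface

/-- `F` pulls the Riemannian metric `h` back to `g`. -/
def IsMetricPreserving {M N : Type*} [TopologicalSpace M]
    [ChartedSpace (EuclideanSpace ℝ (Fin 2)) M] [IsManifold (𝓡 2) ∞ M] [TopologicalSpace N]
    [ChartedSpace (EuclideanSpace ℝ (Fin 2)) N] [IsManifold (𝓡 2) ∞ N]
    (g : SurfaceMetric M) (h : SurfaceMetric N) (F : M → N) : Prop :=
  ∀ (x : M) (u v : TangentSpace (𝓡 2) x),
    h.inner (F x) (mfderiv (𝓡 2) (𝓡 2) F x u) (mfderiv (𝓡 2) (𝓡 2) F x v) = g.inner x u v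

/-- The conformal Wasserstein distance `d^R(M, N) = T^R_d(μ, ν)` of two disk-type surfaces,
where `μ`, `ν` are their conformal factors under the uniformizations `φ`, `ψ`. -/
noncomputable def conformalWassersteinDist {M N : Type*} [TopologicalSpace M]
    [ChartedSpace (EuclideanSpace ℝ (Fin 2)) M] [IsManifold (𝓡 2) ∞ M] [TopologicalSpace N]
    [ChartedSpace (EuclideanSpace ℝ (Fin 2)) N] [IsManifold (𝓡 2) ∞ N]
    {g : SurfaceMetric M} {h : SurfaceMetric N} (R : ℝ)
    (φ : Uniformization g) (ψ : Uniformization h) : ENNReal :=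
  transportCost R φ.conformalFactor ψ.conformalFactor

/-! Zero cost is an infimum over plans, so the Möbius map is extracted by compactness and no optimal
plan is needed. Fix `z₀` and a small neighbourhood `A` of it. As `ν` has finite mass carried by the
disk, some compact `K` satisfies ν(Kᶜ) < μ(A), and every plan gives `A ×ˢ K` mass at least μ(A) -
ν(Kᶜ) > 0. Zero cost therefore forces arbitrarily small local distances on `A ×ˢ K`
(`exists_localDist_lt`). Möbius maps that send some point of one compact set into another have
centres bounded away from the unit circle (`exists_norm_center_le`), so a subsequence converges.
Fatou's lemma and continuity show that the limit satisfies μ = ν ∘ m on a hyperbolic disk about `z₀`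
(`exists_eqOn_hypDisk`).

For neighbouring points, two such maps differ by a Möbius map that preserves `ν` on a hyperbolic
disk of radius larger than `ϱ`; fittability makes it the identity. The local map is thus locally
constant in `z₀`, hence constant on the connected disk (`exists_eqOn_unitDisk`). Since Möbius maps
are hyperbolic isometries, equality of hyperbolic densities is equality of metrics
(`isMetricPreserving_transfer`). -/

/-! ### The group of disk Möbius transformations -/

lemma unitDisk_eq_ball : unitDisk = Metric.ball (0 : ℂ) 1 := by
  ext z; simp [unitDisk]

lemma isOpen_unitDisk : IsOpen unitDisk := unitDisk_eq_ball ▸ Metric.isOpen_ball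

lemma zero_mem_unitDisk : (0 : ℂ) ∈ unitDisk := by simp [unitDisk]

lemma isPreconnected_unitDisk : IsPreconnected unitDisk :=
  unitDisk_eq_ball ▸ (convex_ball (0 : ℂ) 1).isPreconnected

lemma one_sub_norm_sq_pos {z : ℂ} (hz : z ∈ unitDisk) : 0 < 1 - ‖z‖ ^ 2 := by
  have h : ‖z‖ < 1 := hz
  nlinarith [norm_nonneg z]

lemma mem_unitDisk_of_one_sub_pos {z : ℂ} (hz : 0 < 1 - ‖z‖ ^ 2) : z ∈ unitDisk := by
  change ‖z‖ < 1
  nlinarith [norm_nonneg z]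

lemma one_sub_conj_mul_ne_zero {a z : ℂ} (ha : a ∈ unitDisk) (hz : z ∈ unitDisk) :
    1 - conj a * z ≠ 0 := by
  intro h
  have h1 : ‖conj a * z‖ = 1 := by rw [← sub_eq_zero.mp h]; simp
  rw [norm_mul, RCLike.norm_conj] at h1
  have h2 : ‖a‖ < 1 := ha
  have h3 : ‖z‖ < 1 := hz
  nlinarith [norm_nonneg a, norm_nonneg z]

lemma one_sub_mul_conj_ne_zero {a z : ℂ} (ha : a ∈ unitDisk) (hz : z ∈ unitDisk) :
    1 - z * conj a ≠ 0 := by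
  rw [mul_comm]; exact one_sub_conj_mul_ne_zero ha hz

lemma norm_one_sub_conj_mul_sq_sub (a z : ℂ) :
    ‖1 - conj a * z‖ ^ 2 - ‖z - a‖ ^ 2 = (1 - ‖a‖ ^ 2) * (1 - ‖z‖ ^ 2) := by
  simp only [Complex.sq_norm, Complex.normSq_apply, Complex.sub_re, Complex.sub_im,
    Complex.mul_re, Complex.mul_im, Complex.conj_re, Complex.conj_im, Complex.one_re,
    Complex.one_im]
  ring

/-- The Möbius transformation `z ↦ c (z - a) / (1 - conj a * z)`. -/
noncomputable def moebius (c a z : ℂ) : ℂ := c * ((z - a) / (1 - conj a * z))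

lemma one_sub_norm_moebius_sq {c a z : ℂ} (hc : ‖c‖ = 1) (ha : a ∈ unitDisk)
    (hz : z ∈ unitDisk) :
    1 - ‖moebius c a z‖ ^ 2 = (1 - ‖a‖ ^ 2) * (1 - ‖z‖ ^ 2) / ‖1 - conj a * z‖ ^ 2 := by
  have h := norm_ne_zero_iff.mpr (one_sub_conj_mul_ne_zero ha hz)
  rw [moebius, norm_mul, norm_div, hc, one_mul, div_pow, ← norm_one_sub_conj_mul_sq_sub,
    sub_div, div_self (pow_ne_zero 2 h)]

lemma moebius_mem_unitDisk {c a z : ℂ} (hc : ‖c‖ = 1) (ha : a ∈ unitDisk)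
    (hz : z ∈ unitDisk) : moebius c a z ∈ unitDisk := by
  apply mem_unitDisk_of_one_sub_pos
  rw [one_sub_norm_moebius_sq hc ha hz]
  have h := norm_pos_iff.mpr (one_sub_conj_mul_ne_zero ha hz)
  have := one_sub_norm_sq_pos ha
  have := one_sub_norm_sq_pos hz
  positivity

/-- A unimodular constant in place of the angle makes the parameter space circle × disk, where
limits can be taken. -/
lemma mem_diskMobius_iff {m : ℂ → ℂ} :
    m ∈ diskMobius ↔ ∃ a ∈ unitDisk, ∃ c : ℂ, ‖c‖ = 1 ∧ m = moebius c a := by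
  constructor
  · rintro ⟨a, ha, θ, -, rfl⟩
    exact ⟨a, ha, _, Complex.norm_exp_ofReal_mul_I θ, rfl⟩
  · rintro ⟨a, ha, c, hc, rfl⟩
    refine ⟨a, ha, toIcoMod Real.two_pi_pos 0 c.arg, ?_, ?_⟩
    · simpa using toIcoMod_mem_Ico Real.two_pi_pos 0 c.arg
    · have h : Complex.exp ((toIcoMod Real.two_pi_pos 0 c.arg : ℝ) * Complex.I) = c := by
        rw [toIcoMod]
        have := Complex.exp_periodic.sub_zsmul_eq
          (x := c.arg * Complex.I) (toIcoDiv Real.two_pi_pos 0 c.arg)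
        convert this using 1
        · congr 1; push_cast [zsmul_eq_mul]; ring
        · simpa [hc] using (Complex.norm_mul_exp_arg_mul_I c).symm
      rw [h]; rfl

lemma mapsTo_of_mem_diskMobius {m : ℂ → ℂ} (hm : m ∈ diskMobius) :
    Set.MapsTo m unitDisk unitDisk := by
  obtain ⟨a, ha, c, hc, rfl⟩ := mem_diskMobius_iff.mp hm
  exact fun z hz => moebius_mem_unitDisk hc ha hz

lemma conj_mul_self_of_norm_eq_one {c : ℂ} (hc : ‖c‖ = 1) : conj c * c = 1 := by
  rw [Complex.conj_mul', hc]; norm_num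

lemma moebius_moebius_inv {c a z : ℂ} (hc : ‖c‖ = 1) (ha : a ∈ unitDisk) (hz : z ∈ unitDisk) :
    moebius (conj c) (-(c * a)) (moebius c a z) = z := by
  have h1 := one_sub_conj_mul_ne_zero ha hz
  have h1' := one_sub_mul_conj_ne_zero ha hz
  have h2 := conj_mul_self_of_norm_eq_one hc
  have hd' := one_sub_mul_conj_ne_zero ha ha
  have hd : 1 - conj a * a ≠ 0 := one_sub_conj_mul_ne_zero ha ha
  have e1 : moebius c a z - -(c * a) = c * (z * (1 - conj a * a)) / (1 - conj a * z) := by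
    rw [moebius]; field_simp; ring
  have e2 : 1 - conj (-(c * a)) * moebius c a z = (1 - conj a * a) / (1 - conj a * z) := by
    rw [moebius, map_neg, map_mul]; field_simp
    linear_combination (conj a * (z - a)) * h2
  rw [moebius.eq_1 (conj c), e1, e2]
  field_simp
  linear_combination z * h2

lemma exists_inverse_of_mem_diskMobius {m : ℂ → ℂ} (hm : m ∈ diskMobius) :
    ∃ k ∈ diskMobius, (∀ z ∈ unitDisk, k (m z) = z) ∧ ∀ z ∈ unitDisk, m (k z) = z := by
  obtain ⟨a, ha, c, hc, rfl⟩ := mem_diskMobius_iff.mp hm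
  have hc' : ‖conj c‖ = 1 := by simpa using hc
  have ha' : -(c * a) ∈ unitDisk := by
    change ‖-(c * a)‖ < 1
    simpa [hc] using (show ‖a‖ < 1 from ha)
  refine ⟨_, mem_diskMobius_iff.mpr ⟨-(c * a), ha', conj c, hc', rfl⟩,
    fun z hz => moebius_moebius_inv hc ha hz, fun z hz => ?_⟩
  have h := moebius_moebius_inv hc' ha' hz
  have e : -(conj c * -(c * a)) = a := by
    linear_combination a * conj_mul_self_of_norm_eq_one hc
  rwa [Complex.conj_conj, e] at h

lemma exists_comp_of_mem_diskMobius {m k : ℂ → ℂ} (hm : m ∈ diskMobius) (hk : k ∈ diskMobius) :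
    ∃ n ∈ diskMobius, ∀ z ∈ unitDisk, n z = m (k z) := by
  obtain ⟨a, ha, c, hc, rfl⟩ := mem_diskMobius_iff.mp hm
  obtain ⟨b, hb, d, hd, rfl⟩ := mem_diskMobius_iff.mp hk
  have hdd := conj_mul_self_of_norm_eq_one hd
  have hd0 : d ≠ 0 := by rintro rfl; simp at hd
  have hdb : -(d * b) ∈ unitDisk := by
    change ‖-(d * b)‖ < 1
    simpa [hd] using (show ‖b‖ < 1 from hb)
  -- Clearing denominators, the composite is c (p z - (d b + a)) / (q - (conj b + conj a * d) z);
  -- since |p| = |q|, it has centre (d b + a) / p and unimodular constant c p / q.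
  set p : ℂ := d + a * conj b with hp
  set q : ℂ := 1 + conj a * d * b with hq
  have hq0 : q ≠ 0 := by
    have := one_sub_conj_mul_ne_zero ha hdb
    rwa [show 1 - conj a * -(d * b) = q by rw [hq]; ring] at this
  have hpq : p = d * conj q := by
    simp only [hp, hq, map_add, map_mul, map_one, Complex.conj_conj]
    linear_combination (-(a * conj b)) * hdd
  have hpn : ‖p‖ = ‖q‖ := by rw [hpq, norm_mul, hd, RCLike.norm_conj, one_mul]
  have hp0 : p ≠ 0 := by rw [← norm_ne_zero_iff, hpn]; exact norm_ne_zero_iff.mpr hq0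
  have hpc : conj p ≠ 0 := (map_ne_zero _).mpr hp0
  have hqc : q = d * conj p := by
    rw [hpq, map_mul, Complex.conj_conj]; linear_combination (-q) * hdd
  have he : ‖(d * b + a) / p‖ < 1 := by
    have hm' := moebius_mem_unitDisk (c := 1) (by simp) ha hdb
    change ‖moebius 1 a (-(d * b))‖ < 1 at hm'
    rw [moebius, one_mul, norm_div, show 1 - conj a * -(d * b) = q by rw [hq]; ring,
      show -(d * b) - a = -(d * b + a) by ring, norm_neg] at hm'
    rwa [norm_div, hpn]
  refine ⟨_, mem_diskMobius_iff.mpr ⟨(d * b + a) / p, he, c * (p / q), ?_, rfl⟩, fun z hz => ?_⟩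
  · rw [norm_mul, norm_div, hc, hpn, div_self (norm_ne_zero_iff.mpr hq0), one_mul]
  · have h1 := one_sub_conj_mul_ne_zero hb hz
    have h1' := one_sub_mul_conj_ne_zero hb hz
    have h2 := one_sub_conj_mul_ne_zero ha (moebius_mem_unitDisk hd hb hz)
    have h3 := one_sub_conj_mul_ne_zero (a := (d * b + a) / p) he hz
    have e1 : z - (d * b + a) / p = (p * z - (d * b + a)) / p := by field_simp
    have e2 : 1 - conj ((d * b + a) / p) * z = (q - (conj b + conj a * d) * z) / q := by
      have : conj ((d * b + a) / p) = (conj b + conj a * d) / q := by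
        rw [map_div₀, hqc]; field_simp
        simp only [map_add, map_mul]
        linear_combination conj b * hdd
      rw [this]; field_simp
    have e3 : moebius d b z - a = (p * z - (d * b + a)) / (1 - conj b * z) := by
      rw [moebius, hp]; field_simp; ring
    have e4 : 1 - conj a * moebius d b z = (q - (conj b + conj a * d) * z) / (1 - conj b * z) := by
      rw [moebius, hq]; field_simp; ring
    have h4 : q - (conj b + conj a * d) * z ≠ 0 := by
      intro h; rw [e4, h, zero_div] at h2; exact h2 rfl
    rw [moebius.eq_1 c, e3, e4, moebius, e1, e2, div_div_div_cancel_right₀ h1,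
      div_div_div_eq, mul_assoc c, div_mul_div_comm]
    congr 1
    field_simp

/-! ### Hyperbolic disks and compactness of Möbius families -/

/-- The pseudo-hyperbolic distance `|(z - w) / (1 - conj w * z)|`. -/
noncomputable def pseudoDist (w z : ℂ) : ℝ := ‖(z - w) / (1 - conj w * z)‖

lemma pseudoDist_self (w : ℂ) : pseudoDist w w = 0 := by simp [pseudoDist]

lemma one_sub_pseudoDist_sq {w z : ℂ} (hw : w ∈ unitDisk) (hz : z ∈ unitDisk) :
    1 - pseudoDist w z ^ 2 = (1 - ‖w‖ ^ 2) * (1 - ‖z‖ ^ 2) / ‖1 - conj w * z‖ ^ 2 := by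
  have := one_sub_norm_moebius_sq (c := 1) (by simp) hw hz
  rwa [moebius, one_mul] at this

lemma one_sub_conj_moebius_mul_moebius {c a w z : ℂ} (hc : ‖c‖ = 1) (ha : a ∈ unitDisk)
    (hw : w ∈ unitDisk) (hz : z ∈ unitDisk) :
    1 - conj (moebius c a w) * moebius c a z =
      (1 - conj a * a) * (1 - conj w * z) / ((1 - a * conj w) * (1 - conj a * z)) := by
  have h1 := one_sub_conj_mul_ne_zero ha hz
  have h2 : 1 - a * conj w ≠ 0 := by
    have := (map_ne_zero (starRingEnd ℂ)).mpr (one_sub_conj_mul_ne_zero ha hw)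
    simpa using this
  have h1' := one_sub_mul_conj_ne_zero ha hz
  have h2' := one_sub_mul_conj_ne_zero hw ha
  have h4 : 1 - conj w * a ≠ 0 := one_sub_conj_mul_ne_zero hw ha
  have h3 := conj_mul_self_of_norm_eq_one hc
  simp only [moebius, map_mul, map_div₀, map_sub, map_one, Complex.conj_conj]
  field_simp
  linear_combination (-((conj w - conj a) * (z - a))) * h3

lemma pseudoDist_moebius {m : ℂ → ℂ} (hm : m ∈ diskMobius) {w z : ℂ}
    (hw : w ∈ unitDisk) (hz : z ∈ unitDisk) :
    pseudoDist (m w) (m z) = pseudoDist w z := by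
  obtain ⟨a, ha, c, hc, rfl⟩ := mem_diskMobius_iff.mp hm
  have hsq : pseudoDist (moebius c a w) (moebius c a z) ^ 2 = pseudoDist w z ^ 2 := by
    have h := one_sub_pseudoDist_sq (moebius_mem_unitDisk hc ha hw)
      (moebius_mem_unitDisk hc ha hz)
    have h' := one_sub_pseudoDist_sq hw hz
    rw [one_sub_norm_moebius_sq hc ha hw, one_sub_norm_moebius_sq hc ha hz,
      one_sub_conj_moebius_mul_moebius hc ha hw hz, norm_div, norm_mul, norm_mul] at h
    have e1 : ‖1 - a * conj w‖ = ‖1 - conj a * w‖ := by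
      rw [← RCLike.norm_conj (1 - conj a * w)]; simp
    have e2 : ‖1 - conj a * a‖ = 1 - ‖a‖ ^ 2 := by
      rw [Complex.conj_mul', ← Complex.ofReal_pow, ← Complex.ofReal_one, ← Complex.ofReal_sub,
        Complex.norm_real, Real.norm_of_nonneg (one_sub_norm_sq_pos ha).le]
    rw [e1, e2] at h
    have n1 := norm_ne_zero_iff.mpr (one_sub_conj_mul_ne_zero ha hw)
    have n2 := norm_ne_zero_iff.mpr (one_sub_conj_mul_ne_zero ha hz)
    have n3 := norm_ne_zero_iff.mpr (one_sub_conj_mul_ne_zero hw hz)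
    have n4 := (one_sub_norm_sq_pos ha).ne'
    have : 1 - pseudoDist (moebius c a w) (moebius c a z) ^ 2 = 1 - pseudoDist w z ^ 2 := by
      rw [h, h']; field_simp
    linarith
  exact (pow_left_inj₀ (norm_nonneg _) (norm_nonneg _) two_ne_zero).mp hsq

lemma hasDerivAt_moebius {c a z : ℂ} (ha : a ∈ unitDisk) (hz : z ∈ unitDisk) :
    HasDerivAt (moebius c a) (c * ((1 - conj a * a) / (1 - conj a * z) ^ 2)) z := by
  have h := one_sub_conj_mul_ne_zero ha hz
  have h1 : HasDerivAt (fun z : ℂ => z - a) 1 z := (hasDerivAt_id z).sub_const a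
  have h2 : HasDerivAt (fun z : ℂ => 1 - conj a * z) (-(conj a * 1)) z :=
    ((hasDerivAt_id z).const_mul (conj a)).const_sub 1
  have h3 := (h1.div h2 h).const_mul c
  rwa [show 1 * (1 - conj a * z) - (z - a) * -(conj a * 1) = 1 - conj a * a by ring] at h3

/-- A disk Möbius transformation is a hyperbolic isometry. -/
lemma exists_hasDerivAt_of_mem_diskMobius {m : ℂ → ℂ} (hm : m ∈ diskMobius) {z : ℂ}
    (hz : z ∈ unitDisk) :
    ∃ d : ℂ, HasDerivAt m d z ∧ ‖d‖ * (1 - ‖z‖ ^ 2) = 1 - ‖m z‖ ^ 2 := by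
  obtain ⟨a, ha, c, hc, rfl⟩ := mem_diskMobius_iff.mp hm
  refine ⟨_, hasDerivAt_moebius ha hz, ?_⟩
  have e2 : ‖1 - conj a * a‖ = 1 - ‖a‖ ^ 2 := by
    rw [Complex.conj_mul', ← Complex.ofReal_pow, ← Complex.ofReal_one, ← Complex.ofReal_sub,
      Complex.norm_real, Real.norm_of_nonneg (one_sub_norm_sq_pos ha).le]
  rw [one_sub_norm_moebius_sq hc ha hz, norm_mul, norm_div, norm_pow, hc, e2]
  ring

lemma contDiffOn_of_mem_diskMobius {m : ℂ → ℂ} (hm : m ∈ diskMobius) :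
    ContDiffOn ℝ ∞ m unitDisk := by
  obtain ⟨a, ha, c, hc, rfl⟩ := mem_diskMobius_iff.mp hm
  have : ContDiffOn ℂ ∞ (moebius c a) unitDisk :=
    contDiffOn_const.mul ((contDiffOn_id.sub contDiffOn_const).div
      (contDiffOn_const.sub (contDiffOn_const.mul contDiffOn_id))
      fun z hz => one_sub_conj_mul_ne_zero ha hz)
  exact this.restrict_scalars ℝ

lemma tanh_lt_tanh {r s : ℝ} (h : r < s) : Real.tanh r < Real.tanh s := by
  have hm (x : ℝ) : Real.tanh x ∈ Set.Ioo (-1 : ℝ) 1 := Real.tanh_bijOn.mapsTo trivial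
  rwa [← Real.artanh_lt_artanh_iff (hm r) (hm s), Real.artanh_tanh, Real.artanh_tanh]

lemma real_tanh_lt_one (r : ℝ) : Real.tanh r < 1 := (Real.tanh_bijOn.mapsTo trivial).2

lemma continuousAt_pseudoDist {w z : ℂ} (hw : w ∈ unitDisk) (hz : z ∈ unitDisk) :
    ContinuousAt (fun p : ℂ × ℂ => pseudoDist p.1 p.2) (w, z) := by
  unfold pseudoDist
  refine ((continuousAt_snd.sub continuousAt_fst).div (continuousAt_const.sub
    ((Complex.continuous_conj.continuousAt.comp continuousAt_fst).mul continuousAt_snd))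
      (one_sub_conj_mul_ne_zero hw hz)).norm

lemma continuousOn_pseudoDist {w : ℂ} (hw : w ∈ unitDisk) :
    ContinuousOn (pseudoDist w) unitDisk := fun _ hz =>
  ((continuousAt_pseudoDist hw hz).comp
    (f := fun z => (w, z)) (Continuous.prodMk_right w).continuousAt).continuousWithinAt

lemma exists_mem_diskMobius_apply_eq_zero {w : ℂ} (hw : w ∈ unitDisk) :
    ∃ m ∈ diskMobius, ∀ z, ‖m z‖ = pseudoDist w z :=
  ⟨moebius 1 w, mem_diskMobius_iff.mpr ⟨w, hw, 1, by simp, rfl⟩, fun _ => by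
    rw [moebius, one_mul]; rfl⟩

lemma isCompact_hypDisk {w : ℂ} (hw : w ∈ unitDisk) (R : ℝ) : IsCompact (hypDisk w R) := by
  obtain ⟨m, hm, hm0⟩ := exists_mem_diskMobius_apply_eq_zero hw
  obtain ⟨k, hk, hkm, hmk⟩ := exists_inverse_of_mem_diskMobius hm
  have hsub : Metric.closedBall (0 : ℂ) (Real.tanh R) ⊆ unitDisk := fun z hz =>
    lt_of_le_of_lt (by simpa using hz) (real_tanh_lt_one R)
  have : hypDisk w R = k '' Metric.closedBall (0 : ℂ) (Real.tanh R) := by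
    ext z
    constructor
    · rintro ⟨hz, hzR⟩
      exact ⟨m z, by simpa [hm0, pseudoDist] using hzR, hkm z hz⟩
    · rintro ⟨y, hy, rfl⟩
      refine ⟨mapsTo_of_mem_diskMobius hk (hsub hy), ?_⟩
      change pseudoDist w (k y) ≤ _
      rw [← hm0, hmk y (hsub hy)]
      simpa using hy
  rw [this]
  exact (isCompact_closedBall _ _).image_of_continuousOn
    ((contDiffOn_of_mem_diskMobius hk).continuousOn.mono hsub)

/-- The strict bound tanh r < tanh R is an open condition on centre and point jointly, and it
persists uniformly over the compact smaller disk. -/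
lemma eventually_hypDisk_subset {w : ℂ} (hw : w ∈ unitDisk) {r R : ℝ} (h : r < R) :
    ∀ᶠ w' in nhds w, hypDisk w r ⊆ hypDisk w' R := by
  have := (isCompact_hypDisk hw r).eventually_forall_of_forall_eventually (x₀ := w)
    (P := fun w' z => pseudoDist w' z < Real.tanh R) fun z hz =>
      (continuousAt_pseudoDist hw hz.1).eventually
        (isOpen_Iio.mem_nhds (lt_of_le_of_lt hz.2 (tanh_lt_tanh h)))
  filter_upwards [this] with w' hw' z hz
  exact ⟨hz.1, (hw' z hz).le⟩

lemma hypDisk_mono {w : ℂ} {r R : ℝ} (h : r < R) : hypDisk w r ⊆ hypDisk w R :=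
  fun _ hz => ⟨hz.1, hz.2.trans (tanh_lt_tanh h).le⟩

/-- With m = `moebius c a`, the identity (1 - |m z|²) |1 - conj a * z|² = (1 - |a|²)(1 - |z|²) gives
(1 - k²)(1 - k)² ≤ 1 - |a|². This is the compactness of the family of maps sending some point of the
ball of radius `k` into that ball. -/
lemma exists_norm_center_le {k : ℝ} (hk0 : 0 ≤ k) (hk : k < 1) :
    ∃ s < 1, ∀ c a z : ℂ, ‖c‖ = 1 → a ∈ unitDisk → ‖z‖ ≤ k → ‖moebius c a z‖ ≤ k → ‖a‖ ≤ s := by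
  have h1 : 0 < 1 - k ^ 2 := by nlinarith
  have h2 : 0 < (1 - k) ^ 2 := pow_pos (by linarith) 2
  have h3 := mul_pos h1 h2
  refine ⟨√(1 - (1 - k ^ 2) * (1 - k) ^ 2),
    (Real.sqrt_lt_sqrt_iff_of_pos one_pos).mpr (by linarith) |>.trans_eq Real.sqrt_one,
    fun c a z hc ha hz hm => ?_⟩
  apply Real.le_sqrt_of_sq_le
  have hz' : z ∈ unitDisk := lt_of_le_of_lt hz hk
  have h := one_sub_norm_moebius_sq hc ha hz'
  have hn := norm_pos_iff.mpr (one_sub_conj_mul_ne_zero ha hz')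
  rw [eq_div_iff (by positivity)] at h
  have ha' : ‖a‖ < 1 := ha
  have h4 : 1 - k ≤ ‖1 - conj a * z‖ := by
    have h5 := norm_sub_norm_le (1 : ℂ) (conj a * z)
    rw [norm_one, norm_mul, RCLike.norm_conj] at h5
    nlinarith [norm_nonneg a, norm_nonneg z]
  have h6 : (1 - k) ^ 2 ≤ ‖1 - conj a * z‖ ^ 2 := by gcongr
  have h7 : 1 - k ^ 2 ≤ 1 - ‖moebius c a z‖ ^ 2 := by gcongr
  have h8 : (1 - k ^ 2) * (1 - k) ^ 2 ≤ (1 - ‖a‖ ^ 2) * (1 - ‖z‖ ^ 2) := by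
    rw [← h]; exact mul_le_mul h7 h6 h2.le (h1.le.trans h7)
  have h9 : (1 - ‖a‖ ^ 2) * (1 - ‖z‖ ^ 2) ≤ 1 - ‖a‖ ^ 2 :=
    mul_le_of_le_one_right (one_sub_norm_sq_pos ha).le (by nlinarith [norm_nonneg z])
  linarith

/-! ### Hyperbolic area and the density measures -/

lemma measurableSet_unitDisk : MeasurableSet unitDisk := isOpen_unitDisk.measurableSet

lemma volH_absolutelyContinuous : volH ≪ volume.restrict unitDisk :=
  withDensity_absolutelyContinuous _ _

lemma absolutelyContinuous_volH : volume.restrict unitDisk ≪ volH := by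
  refine withDensity_absolutelyContinuous' (by fun_prop) ?_
  filter_upwards [ae_restrict_mem measurableSet_unitDisk] with z hz
  have := one_sub_norm_sq_pos hz
  simp only [ne_eq, ENNReal.ofReal_eq_zero, not_le]
  positivity

lemma aemeasurable_volH_of_continuousOn {X : Type*} [TopologicalSpace X] [MeasurableSpace X]
    [BorelSpace X] {f : ℂ → X} [TopologicalSpace.PseudoMetrizableSpace X]
    (hf : ContinuousOn f unitDisk) : AEMeasurable f volH :=
  (hf.aemeasurable measurableSet_unitDisk).mono_ac volH_absolutelyContinuous

lemma ae_volH_mem_unitDisk : ∀ᵐ z ∂volH, z ∈ unitDisk :=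
  volH_absolutelyContinuous.ae_le (ae_restrict_mem measurableSet_unitDisk)

section

variable {μ ν : ℂ → ℝ}

lemma densityMeasure_compl_unitDisk (ν : ℂ → ℝ) : densityMeasure ν unitDiskᶜ = 0 :=
  withDensity_absolutelyContinuous _ _ ae_volH_mem_unitDisk

lemma densityMeasure_ne_zero (hμ : ContinuousOn μ unitDisk) (hpos : ∀ z ∈ unitDisk, 0 < μ z)
    {A : Set ℂ} (hA : IsOpen A) (hA0 : A.Nonempty) (hAD : A ⊆ unitDisk) :
    densityMeasure μ A ≠ 0 := by
  have hac : volH ≪ densityMeasure μ := by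
    refine withDensity_absolutelyContinuous'
      (aemeasurable_volH_of_continuousOn hμ).ennreal_ofReal ?_
    filter_upwards [ae_volH_mem_unitDisk] with z hz
    simpa using hpos z hz
  intro h
  have h0 := absolutelyContinuous_volH (hac h)
  rw [Measure.restrict_apply hA.measurableSet, Set.inter_eq_left.mpr hAD] at h0
  exact (hA.measure_pos volume hA0).ne' h0

/-- `K` is chosen before `ε`; this uniformity is what later confines the Möbius maps. Bounding the
integrand below by a constant requires no measurability of `localDist`. -/
lemma exists_localDist_lt {R : ℝ} (hν : densityMeasure ν Set.univ ≠ ⊤)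
    (hzero : transportCost R μ ν = 0) {A : Set ℂ} (hA : MeasurableSet A) (hAD : A ⊆ unitDisk)
    (hA0 : densityMeasure μ A ≠ 0) :
    ∃ K ⊆ unitDisk, IsCompact K ∧
      ∀ ε : ENNReal, ε ≠ 0 → ∃ z ∈ A, ∃ w ∈ K, localDist R μ ν z w < ε := by
  have : IsFiniteMeasure (densityMeasure ν) := ⟨lt_top_iff_ne_top.mpr hν⟩
  obtain ⟨K, hKD, hK, hlt⟩ := measurableSet_unitDisk.exists_isCompact_sdiff_lt
    (measure_ne_top (densityMeasure ν) _) hA0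
  have hKc : densityMeasure ν Kᶜ < densityMeasure μ A := by
    refine lt_of_le_of_lt ?_ hlt
    calc densityMeasure ν Kᶜ ≤ densityMeasure ν ((unitDisk \ K) ∪ unitDiskᶜ) := by
          apply measure_mono
          intro z hz
          by_cases h : z ∈ unitDisk
          · exact Or.inl ⟨h, hz⟩
          · exact Or.inr h
      _ ≤ densityMeasure ν (unitDisk \ K) + densityMeasure ν unitDiskᶜ := measure_union_le _ _
      _ = densityMeasure ν (unitDisk \ K) := by rw [densityMeasure_compl_unitDisk, add_zero]
  refine ⟨K, hKD, hK, fun ε hε => ?_⟩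
  by_contra! hcon
  set δ := densityMeasure μ A - densityMeasure ν Kᶜ with hδ
  have hδ0 : δ ≠ 0 := (tsub_pos_of_lt hKc).ne'
  have hle : ε * δ ≤ transportCost R μ ν := by
    refine le_iInf₂ fun π hπ => ?_
    -- The strip over `A` is covered by `A ×ˢ K` and the points whose second coordinate lies in
    -- `Kᶜ`; the marginals give the masses.
    have hAK : δ ≤ π (A ×ˢ K) := by
      rw [hδ, tsub_le_iff_right, ← hπ.1, ← hπ.2, Measure.map_apply measurable_fst hA,
        Measure.map_apply measurable_snd hK.measurableSet.compl]
      refine (measure_mono fun p hp => ?_).trans (measure_union_le _ _)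
      by_cases h : p.2 ∈ K
      · exact Or.inl ⟨hp, h⟩
      · exact Or.inr h
    calc ε * δ ≤ ε * π (A ×ˢ K) := by gcongr
      _ = ∫⁻ _ in A ×ˢ K, ε ∂π := by rw [setLIntegral_const]
      _ ≤ ∫⁻ p in A ×ˢ K, localDist R μ ν p.1 p.2 ∂π :=
          setLIntegral_mono' (hA.prod hK.measurableSet) fun p hp => hcon _ hp.1 _ hp.2
      _ ≤ _ := lintegral_mono_set (Set.prod_mono hAD hKD)
  rw [hzero, nonpos_iff_eq_zero, mul_eq_zero] at hle
  exact hle.elim hε hδ0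

lemma exists_eqOn_hypDisk_of_tendsto (hμ : ContinuousOn μ unitDisk)
    (hν : ContinuousOn ν unitDisk) {z₀ : ℂ} (hz₀ : z₀ ∈ unitDisk) {r R : ℝ} (hr : r < R)
    {s : ℝ} (hs : s < 1) {c a : ℕ → ℂ} (hc : ∀ n, ‖c n‖ = 1) (ha : ∀ n, ‖a n‖ ≤ s)
    (hlim : Filter.Tendsto (fun n => patchDiscrepancy R μ ν (moebius (c n) (a n)) z₀)
      Filter.atTop (nhds 0)) :
    ∃ m ∈ diskMobius, Set.EqOn μ (ν ∘ m) (hypDisk z₀ r) := by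
  obtain ⟨⟨c₀, a₀⟩, h₀, φ, hφ, hφlim⟩ :=
    ((isCompact_sphere (0 : ℂ) 1).prod (isCompact_closedBall (0 : ℂ) s)).tendsto_subseq
      (x := fun n => (c n, a n)) fun n => ⟨by simp [hc n], by simp [ha n]⟩
  have hc₀ : ‖c₀‖ = 1 := by simpa using h₀.1
  have ha₀ : a₀ ∈ unitDisk := lt_of_le_of_lt (by simpa using h₀.2) hs
  have haD (n) : a n ∈ unitDisk := lt_of_le_of_lt (ha n) hs
  have hm : moebius c₀ a₀ ∈ diskMobius := mem_diskMobius_iff.mpr ⟨a₀, ha₀, c₀, hc₀, rfl⟩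
  have hcl : Filter.Tendsto (fun n => c (φ n)) Filter.atTop (nhds c₀) :=
    (continuous_fst.tendsto _).comp hφlim
  have hal : Filter.Tendsto (fun n => a (φ n)) Filter.atTop (nhds a₀) :=
    (continuous_snd.tendsto _).comp hφlim
  have hcont {c a : ℂ} (hc : ‖c‖ = 1) (ha : a ∈ unitDisk) :
      ContinuousOn (fun z => ν (moebius c a z)) unitDisk :=
    hν.comp (contDiffOn_of_mem_diskMobius
      (mem_diskMobius_iff.mpr ⟨a, ha, c, hc, rfl⟩)).continuousOn
      fun z hz => moebius_mem_unitDisk hc ha hz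
  have hpt : ∀ z ∈ unitDisk, Filter.Tendsto (fun n => ENNReal.ofReal
      |μ z - ν (moebius (c (φ n)) (a (φ n)) z)|) Filter.atTop
      (nhds (ENNReal.ofReal |μ z - ν (moebius c₀ a₀ z)|)) := fun z hz => by
    have h1 : Filter.Tendsto (fun n => moebius (c (φ n)) (a (φ n)) z) Filter.atTop
        (nhds (moebius c₀ a₀ z)) :=
      hcl.mul ((tendsto_const_nhds.sub hal).div (tendsto_const_nhds.sub
        (((Complex.continuous_conj.tendsto _).comp hal).mul tendsto_const_nhds))
          (one_sub_conj_mul_ne_zero ha₀ hz))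
    have h2 := (hν.continuousAt
      (isOpen_unitDisk.mem_nhds (moebius_mem_unitDisk hc₀ ha₀ hz))).tendsto.comp h1
    exact ENNReal.tendsto_ofReal (tendsto_const_nhds.sub h2).abs
  have hzero : patchDiscrepancy R μ ν (moebius c₀ a₀) z₀ = 0 := by
    refine le_antisymm ?_ zero_le
    calc patchDiscrepancy R μ ν (moebius c₀ a₀) z₀
        = ∫⁻ z in hypDisk z₀ R, Filter.liminf (fun n => ENNReal.ofReal
            |μ z - ν (moebius (c (φ n)) (a (φ n)) z)|) Filter.atTop ∂volH := by
          refine lintegral_congr_ae ?_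
          filter_upwards [ae_restrict_of_ae ae_volH_mem_unitDisk] with z hz
          exact (hpt z hz).liminf_eq.symm
      _ ≤ Filter.liminf (fun n => patchDiscrepancy R μ ν (moebius (c (φ n)) (a (φ n))) z₀)
            Filter.atTop := lintegral_liminf_le' fun n =>
          ((aemeasurable_volH_of_continuousOn
            (hμ.sub (hcont (hc _) (haD _))).abs).ennreal_ofReal).restrict
      _ = 0 := (hlim.comp hφ.tendsto_atTop).liminf_eq
  -- Almost everywhere equality of continuous functions upgrades to equality on an open set, hence
  -- the open disk here and the smaller closed radius `r` in the conclusion.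
  set U : Set ℂ := unitDisk ∩ pseudoDist z₀ ⁻¹' Set.Iio (Real.tanh R) with hU
  have hUo : IsOpen U :=
    (continuousOn_pseudoDist hz₀).isOpen_inter_preimage isOpen_unitDisk isOpen_Iio
  have hUD : U ⊆ unitDisk := Set.inter_subset_left
  have hUs : U ⊆ hypDisk z₀ R := fun z hz => ⟨hz.1, le_of_lt hz.2⟩
  have hae : μ =ᵐ[volume.restrict U] fun z => ν (moebius c₀ a₀ z) := by
    have hac : volume.restrict U ≪ volH.restrict (hypDisk z₀ R) := by
      have h1 := absolutelyContinuous_volH.restrict U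
      rw [Measure.restrict_restrict hUo.measurableSet, Set.inter_eq_left.mpr hUD] at h1
      exact h1.trans (Measure.restrict_mono hUs le_rfl).absolutelyContinuous
    refine hac.ae_le ?_
    have h2 := (lintegral_eq_zero_iff' ((aemeasurable_volH_of_continuousOn
      (hμ.sub (hcont hc₀ ha₀)).abs).ennreal_ofReal).restrict).mp hzero
    filter_upwards [h2] with z hz
    simpa [sub_eq_zero] using hz
  have heq := Measure.eqOn_open_of_ae_eq hae hUo (hμ.mono hUD) ((hcont hc₀ ha₀).mono hUD)
  exact ⟨_, hm, fun z hz => heq ⟨hz.1, lt_of_le_of_lt hz.2 (tanh_lt_tanh hr)⟩⟩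

lemma patchDiscrepancy_mono {R₁ R₂ : ℝ} {z₁ z₂ : ℂ} (h : hypDisk z₁ R₁ ⊆ hypDisk z₂ R₂)
    (m : ℂ → ℂ) : patchDiscrepancy R₁ μ ν m z₁ ≤ patchDiscrepancy R₂ μ ν m z₂ :=
  lintegral_mono_set h

/-- If the transportation cost vanishes, then `μ` and `ν` agree, near each point, up to a disk
Möbius transformation. -/
lemma exists_eqOn_hypDisk (hμ : ContinuousOn μ unitDisk) (hν : ContinuousOn ν unitDisk)
    (hpos : ∀ z ∈ unitDisk, 0 < μ z) (hfin : densityMeasure ν Set.univ ≠ ⊤) {r R : ℝ}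
    (hr : r < R) (hzero : transportCost R μ ν = 0) {z₀ : ℂ} (hz₀ : z₀ ∈ unitDisk) :
    ∃ m ∈ diskMobius, Set.EqOn μ (ν ∘ m) (hypDisk z₀ r) := by
  -- The loss from `R` to `r'` moves the centre from a nearby `z ∈ A` to `z₀`; the loss from `r'` to
  -- `r` is the one in the limit argument.
  obtain ⟨r', hr', hr'R⟩ := exists_between hr
  obtain ⟨l, hl0, hl1⟩ := exists_between (show ‖z₀‖ < 1 from hz₀)
  have hl : ∀ᶠ z in nhds z₀, ‖z‖ < l :=
    continuous_norm.continuousAt.eventually (isOpen_Iio.mem_nhds hl0)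
  obtain ⟨A, hAs, hAo, hzA⟩ :=
    eventually_nhds_iff.mp ((eventually_hypDisk_subset hz₀ hr'R).and hl)
  have hAD : A ⊆ unitDisk := fun z hz => (hAs z hz).2.trans hl1
  obtain ⟨K, hKD, hK, hKlt⟩ := exists_localDist_lt hfin hzero hAo.measurableSet hAD
    (densityMeasure_ne_zero hμ hpos hAo ⟨z₀, hzA⟩ hAD)
  obtain ⟨l', hl'0, hl'1, hl'K⟩ : ∃ l' ≥ 0, l' < 1 ∧ ∀ w ∈ K, ‖w‖ ≤ l' := by
    rcases K.eq_empty_or_nonempty with rfl | hne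
    · exact ⟨0, le_rfl, one_pos, by simp⟩
    · obtain ⟨x, hx, hmax⟩ := hK.exists_isMaxOn hne continuous_norm.continuousOn
      exact ⟨‖x‖, norm_nonneg _, hKD hx, fun w hw => hmax hw⟩
  obtain ⟨s, hs, hbound⟩ := exists_norm_center_le (le_max_of_le_right hl'0 : 0 ≤ max l l')
    (max_lt hl1 hl'1)
  have hseq (n : ℕ) : ∃ c a : ℂ, ‖c‖ = 1 ∧ ‖a‖ ≤ s ∧
      patchDiscrepancy r' μ ν (moebius c a) z₀ ≤ ((n : ENNReal) + 1)⁻¹ := by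
    obtain ⟨z, hz, w, hw, hlt⟩ := hKlt ((n : ENNReal) + 1)⁻¹ (by simp)
    simp only [localDist, iInf_lt_iff] at hlt
    obtain ⟨m, hm, hmz, hlt⟩ := hlt
    obtain ⟨a, ha, c, hc, rfl⟩ := mem_diskMobius_iff.mp hm
    refine ⟨c, a, hc, hbound c a z hc ha ((hAs z hz).2.le.trans (le_max_left _ _)) ?_,
      (patchDiscrepancy_mono (hAs z hz).1 _).trans hlt.le⟩
    rw [hmz]
    exact (hl'K w hw).trans (le_max_right _ _)
  choose c a hc ha hca using hseq
  refine exists_eqOn_hypDisk_of_tendsto hμ hν hz₀ hr' hs hc ha ?_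
  refine tendsto_of_tendsto_of_tendsto_of_le_of_le tendsto_const_nhds ?_
    (fun _ => zero_le) hca
  have h := (Filter.tendsto_add_atTop_iff_nat 1).mpr ENNReal.tendsto_inv_nat_nhds_zero
  simpa using h

/-- If moreover only the identity preserves `ν` on a hyperbolic disk of radius `r`, then the disk
Möbius transformation can be chosen independently of the point. -/
lemma exists_eqOn_unitDisk {r R : ℝ} (hrpos : 0 < r) (hr : r < R)
    (hloc : ∀ z ∈ unitDisk, ∃ m ∈ diskMobius, Set.EqOn μ (ν ∘ m) (hypDisk z R))
    (hfit : ∀ z ∈ unitDisk, ∀ m ∈ diskMobius, Set.EqOn ν (ν ∘ m) (hypDisk z r) →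
      ∀ w ∈ unitDisk, m w = w) :
    ∃ m ∈ diskMobius, ∀ z ∈ unitDisk, μ z = ν (m z) := by
  have hself {z : ℂ} (hz : z ∈ unitDisk) {R : ℝ} (hR : 0 < R) : z ∈ hypDisk z R := by
    refine ⟨hz, ?_⟩
    change pseudoDist z z ≤ _
    rw [pseudoDist_self, ← Real.tanh_zero]
    exact (tanh_lt_tanh hR).le
  have huniq {z : ℂ} (hz : z ∈ unitDisk) {m m' : ℂ → ℂ} (hm : m ∈ diskMobius)
      (hm' : m' ∈ diskMobius) (h : Set.EqOn μ (ν ∘ m) (hypDisk z r))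
      (h' : Set.EqOn μ (ν ∘ m') (hypDisk z r)) : Set.EqOn m m' unitDisk := by
    obtain ⟨k, hk, hkm, hmk⟩ := exists_inverse_of_mem_diskMobius hm
    obtain ⟨n, hn, hnk⟩ := exists_comp_of_mem_diskMobius hm' hk
    -- m' ∘ m⁻¹ acts on the side of `ν`, so fittability is applied on the disk about `m z`, whose
    -- points `m`⁻¹ carries into the disk about `z`.
    have hid := hfit (m z) (mapsTo_of_mem_diskMobius hm hz) n hn fun w hw => by
      have hkw : k w ∈ hypDisk z r := by
        refine ⟨mapsTo_of_mem_diskMobius hk hw.1, ?_⟩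
        change pseudoDist z (k w) ≤ _
        rw [← pseudoDist_moebius hm hz (mapsTo_of_mem_diskMobius hk hw.1), hmk w hw.1]
        exact hw.2
      have h1 := h hkw
      have h2 := h' hkw
      simp only [Function.comp_apply] at h1 h2 ⊢
      rw [hnk w hw.1, ← h2, h1, hmk w hw.1]
    intro w hw
    have := hid (m w) (mapsTo_of_mem_diskMobius hm hw)
    rw [hnk _ (mapsTo_of_mem_diskMobius hm hw), hkm w hw] at this
    exact this.symm
  choose! k hk hkeq using hloc
  refine ⟨k 0, hk 0 zero_mem_unitDisk, fun z hz => ?_⟩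
  have hconst : Set.EqOn (k 0) (k z) unitDisk := by
    refine isPreconnected_unitDisk.induction₂ (fun x y => Set.EqOn (k x) (k y) unitDisk)
      (fun x hx => ?_) (fun x y w _ _ _ h h' => h.trans h') (fun x y _ _ h => h.symm)
      zero_mem_unitDisk hz
    -- For `y` near `x` the smaller disk about `x` lies in the larger disk about `y`, so both `k x`
    -- and `k y` match `μ` with `ν` there.
    filter_upwards [nhdsWithin_le_nhds (eventually_hypDisk_subset hx hr),
      self_mem_nhdsWithin] with y hy hyD
    exact huniq hx (hk x hx) (hk y hyD) ((hkeq x hx).mono (hypDisk_mono hr))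
      ((hkeq y hyD).mono hy)
  rw [hconst hz]
  exact hkeq z hz (hself hz (hrpos.trans hr))

end

/-! ### Uniformizations and the regularity of the conformal factor -/

section

variable {M : Type*} [TopologicalSpace M] [ChartedSpace (EuclideanSpace ℝ (Fin 2)) M]
  [IsManifold (𝓡 2) ∞ M] {g : SurfaceMetric M}

namespace Uniformization

lemma mdifferentiableAt_toFun (φ : Uniformization g) (x : M) :
    MDifferentiableAt (𝓡 2) 𝓘(ℝ, ℂ) φ.toFun x :=
  φ.contMDiff_toFun.mdifferentiable (by simp) x

lemma contMDiffAt_invFun (φ : Uniformization g) {z : ℂ} (hz : z ∈ unitDisk) :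
    ContMDiffAt 𝓘(ℝ, ℂ) (𝓡 2) ∞ φ.invFun z :=
  φ.contMDiffOn_invFun.contMDiffAt (isOpen_unitDisk.mem_nhds hz)

lemma mdifferentiableAt_invFun (φ : Uniformization g) {z : ℂ} (hz : z ∈ unitDisk) :
    MDifferentiableAt 𝓘(ℝ, ℂ) (𝓡 2) φ.invFun z :=
  (φ.contMDiffAt_invFun hz).mdifferentiableAt (by simp)

lemma mfderiv_toFun_mfderiv_invFun (φ : Uniformization g) {z : ℂ} (hz : z ∈ unitDisk) (a : ℂ) :
    mfderiv (𝓡 2) 𝓘(ℝ, ℂ) φ.toFun (φ.invFun z) (mfderiv 𝓘(ℝ, ℂ) (𝓡 2) φ.invFun z a) = a := by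
  have h := mfderiv_comp_apply z (φ.mdifferentiableAt_toFun _) (φ.mdifferentiableAt_invFun hz) a
  rw [← h, Filter.EventuallyEq.mfderiv_eq (f := id), mfderiv_id]
  · rfl
  · filter_upwards [isOpen_unitDisk.mem_nhds hz] with w hw using φ.right_inv w hw

lemma mfderiv_invFun_mfderiv_toFun (φ : Uniformization g) (x : M) (u : TangentSpace (𝓡 2) x) :
    mfderiv 𝓘(ℝ, ℂ) (𝓡 2) φ.invFun (φ.toFun x) (mfderiv (𝓡 2) 𝓘(ℝ, ℂ) φ.toFun x u) = u := by
  have h := mfderiv_comp_apply x (φ.mdifferentiableAt_invFun (φ.mem_unitDisk x))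
    (φ.mdifferentiableAt_toFun x) u
  rw [← h, Filter.EventuallyEq.mfderiv_eq (f := id), mfderiv_id]
  · rfl
  · exact Filter.Eventually.of_forall fun y => φ.left_inv y

lemma metricInCoord_eq (φ : Uniformization g) {z : ℂ} (hz : z ∈ unitDisk) (a b : ℂ) :
    metricInCoord g φ.invFun z a b = φ.euclideanFactor z * inner ℝ a b := by
  obtain ⟨c, hc⟩ := φ.conformal z hz
  rw [euclideanFactor, hc, hc]
  simp

/-- The tangent vector `u` at `x` in the coordinate given by `φ`. -/
noncomputable def pushforward (φ : Uniformization g) (x : M) (u : TangentSpace (𝓡 2) x) : ℂ :=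
  mfderiv (𝓡 2) 𝓘(ℝ, ℂ) φ.toFun x u

lemma inner_eq (φ : Uniformization g) (x : M) (u v : TangentSpace (𝓡 2) x) :
    g.inner x u v =
      φ.euclideanFactor (φ.toFun x) * inner ℝ (φ.pushforward x u) (φ.pushforward x v) := by
  -- `φ.invFun (φ.toFun x)` equals `x` only propositionally, so vectors in both tangent spaces are
  -- read in the common model space.
  have hbase : ∀ y, y = x → ∀ u v : EuclideanSpace ℝ (Fin 2),
      (g.inner y : EuclideanSpace ℝ (Fin 2) →L[ℝ] EuclideanSpace ℝ (Fin 2) →L[ℝ] ℝ) u v =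
        (g.inner x : EuclideanSpace ℝ (Fin 2) →L[ℝ] EuclideanSpace ℝ (Fin 2) →L[ℝ] ℝ) u v := by
    rintro y rfl u v; rfl
  rw [← φ.metricInCoord_eq (φ.mem_unitDisk x)]
  refine ((hbase _ (φ.left_inv x) _ _).trans ?_).symm
  exact congrArg₂ (fun u v : TangentSpace (𝓡 2) x => g.inner x u v)
    (φ.mfderiv_invFun_mfderiv_toFun x u) (φ.mfderiv_invFun_mfderiv_toFun x v)

lemma euclideanFactor_pos (φ : Uniformization g) {z : ℂ} (hz : z ∈ unitDisk) :
    0 < φ.euclideanFactor z := by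
  refine g.pos _ _ fun h => ?_
  have h1 := φ.mfderiv_toFun_mfderiv_invFun hz 1
  rw [h, map_zero] at h1
  exact zero_ne_one (α := ℂ) h1

lemma conformalFactor_pos (φ : Uniformization g) {z : ℂ} (hz : z ∈ unitDisk) :
    0 < φ.conformalFactor z :=
  mul_pos (pow_pos (one_sub_norm_sq_pos hz) 2) (φ.euclideanFactor_pos hz)

/-- The coordinate field, the image of 1 under the derivative of `φ.invFun`, is continuous into the
tangent bundle, and the metric is a continuous field of bilinear forms. -/
lemma continuousOn_euclideanFactor (φ : Uniformization g) :
    ContinuousOn φ.euclideanFactor unitDisk := by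
  have hv : ContinuousOn (fun z : ℂ => (Bundle.TotalSpace.mk' (EuclideanSpace ℝ (Fin 2))
      (φ.invFun z) (mfderiv 𝓘(ℝ, ℂ) (𝓡 2) φ.invFun z (1 : ℂ)) :
      TangentBundle (𝓡 2) M)) unitDisk := by
    have h1 := φ.contMDiffOn_invFun.continuousOn_tangentMapWithin (by simp)
      isOpen_unitDisk.uniqueMDiffOn
    have h2 : Continuous fun z : ℂ => (Bundle.TotalSpace.mk' ℂ z (1 : ℂ) :
        TangentBundle 𝓘(ℝ, ℂ) ℂ) :=
      (tangentBundleModelSpaceHomeomorph 𝓘(ℝ, ℂ)).symm.continuous.comp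
        (Continuous.prodMk_left (1 : ℂ))
    refine (h1.comp h2.continuousOn fun z hz => hz).congr fun z hz => ?_
    simp only [Function.comp_apply, tangentMapWithin]
    rw [mfderivWithin_of_isOpen isOpen_unitDisk hz]
  intro z hz
  have h := (g.contMDiff.continuous.continuousAt.comp_continuousWithinAt
    (φ.contMDiffOn_invFun.continuousOn z hz)).clm_bundle_apply₂
    (F₁ := EuclideanSpace ℝ (Fin 2)) (F₂ := EuclideanSpace ℝ (Fin 2))
    (E₃ := Bundle.Trivial M ℝ) (hv z hz) (hv z hz)
  simp only [FiberBundle.continuousWithinAt_totalSpace] at h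
  exact h.2

lemma continuousOn_conformalFactor (φ : Uniformization g) :
    ContinuousOn φ.conformalFactor unitDisk := by
  refine ContinuousOn.mul ?_ φ.continuousOn_euclideanFactor
  fun_prop

lemma densityMeasure_univ (φ : Uniformization g) :
    densityMeasure φ.conformalFactor Set.univ = φ.area := by
  rw [densityMeasure, withDensity_apply _ MeasurableSet.univ, Measure.restrict_univ, volH,
    lintegral_withDensity_eq_lintegral_mul₀ (by fun_prop)
      (φ.continuousOn_conformalFactor.aemeasurable measurableSet_unitDisk).ennreal_ofReal, area]
  refine setLIntegral_congr_fun measurableSet_unitDisk fun z hz => ?_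
  have h := one_sub_norm_sq_pos hz
  simp only [Pi.mul_apply]
  rw [← ENNReal.ofReal_mul (by positivity), conformalFactor]
  congr 1
  field_simp

end Uniformization

end

/-! ### From Möbius maps to isometries of surfaces -/

section

variable {M N : Type*} [TopologicalSpace M] [ChartedSpace (EuclideanSpace ℝ (Fin 2)) M]
  [IsManifold (𝓡 2) ∞ M] [TopologicalSpace N] [ChartedSpace (EuclideanSpace ℝ (Fin 2)) N]
  [IsManifold (𝓡 2) ∞ N] {g : SurfaceMetric M} {h : SurfaceMetric N}

lemma patchDiscrepancy_eq_zero {R : ℝ} {μ ν : ℂ → ℝ} {m : ℂ → ℂ} {z₀ : ℂ} (hz₀ : z₀ ∈ unitDisk)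
    (heq : Set.EqOn μ (ν ∘ m) (hypDisk z₀ R)) : patchDiscrepancy R μ ν m z₀ = 0 := by
  rw [patchDiscrepancy, setLIntegral_congr_fun (g := 0) (isCompact_hypDisk hz₀ R).measurableSet
    fun z hz => by simp [heq hz]]
  simp

lemma contMDiff_transfer (φ : Uniformization g) (ψ : Uniformization h) {m : ℂ → ℂ}
    (hm : m ∈ diskMobius) :
    ContMDiff (𝓡 2) (𝓡 2) ∞ fun x => ψ.invFun (m (φ.toFun x)) := fun x => by
  have h1 : ContMDiffAt 𝓘(ℝ, ℂ) 𝓘(ℝ, ℂ) ∞ m (φ.toFun x) :=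
    ((contDiffOn_of_mem_diskMobius hm).contDiffAt
      (isOpen_unitDisk.mem_nhds (φ.mem_unitDisk x))).contMDiffAt
  exact (ψ.contMDiffAt_invFun (mapsTo_of_mem_diskMobius hm (φ.mem_unitDisk x))).comp x
    (h1.comp x (φ.contMDiff_toFun x))

/-- The diffeomorphism that a disk Möbius transformation induces between two uniformized
surfaces. -/
lemma exists_diffeomorph (φ : Uniformization g) (ψ : Uniformization h) {m : ℂ → ℂ}
    (hm : m ∈ diskMobius) :
    ∃ F : M ≃ₘ^∞⟮𝓡 2, 𝓡 2⟯ N, ∀ x, F x = ψ.invFun (m (φ.toFun x)) := by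
  obtain ⟨k, hk, hkm, hmk⟩ := exists_inverse_of_mem_diskMobius hm
  refine ⟨{ toFun := fun x => ψ.invFun (m (φ.toFun x))
            invFun := fun y => φ.invFun (k (ψ.toFun y))
            left_inv := fun x => ?_
            right_inv := fun y => ?_
            contMDiff_toFun := contMDiff_transfer φ ψ hm
            contMDiff_invFun := contMDiff_transfer ψ φ hk }, fun _ => rfl⟩
  · simp only
    rw [ψ.right_inv _ (mapsTo_of_mem_diskMobius hm (φ.mem_unitDisk x)),
      hkm _ (φ.mem_unitDisk x), φ.left_inv]
  · simp only
    rw [φ.right_inv _ (mapsTo_of_mem_diskMobius hk (ψ.mem_unitDisk y)),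
      hmk _ (ψ.mem_unitDisk y), ψ.left_inv]

lemma isMetricPreserving_transfer (φ : Uniformization g) (ψ : Uniformization h) {m : ℂ → ℂ}
    (hm : m ∈ diskMobius)
    (heq : ∀ z ∈ unitDisk, φ.conformalFactor z = ψ.conformalFactor (m z)) :
    IsMetricPreserving g h fun x => ψ.invFun (m (φ.toFun x)) := by
  intro x u v
  have hz := φ.mem_unitDisk x
  have hmz := mapsTo_of_mem_diskMobius hm hz
  obtain ⟨d, hd, hdn⟩ := exists_hasDerivAt_of_mem_diskMobius hm hz
  have hderiv (u : TangentSpace (𝓡 2) x) :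
      mfderiv (𝓡 2) (𝓡 2) (fun x => ψ.invFun (m (φ.toFun x))) x u =
        mfderiv 𝓘(ℝ, ℂ) (𝓡 2) ψ.invFun (m (φ.toFun x)) (d * φ.pushforward x u) := by
    have hmd : HasMFDerivAt 𝓘(ℝ, ℂ) 𝓘(ℝ, ℂ) m (φ.toFun x)
        ((ContinuousLinearMap.toSpanSingleton ℂ d).restrictScalars ℝ) :=
      (hd.hasFDerivAt.restrictScalars ℝ).hasMFDerivAt
    have h1 := (ψ.mdifferentiableAt_invFun hmz).hasMFDerivAt.comp x
      (hmd.comp x (φ.mdifferentiableAt_toFun x).hasMFDerivAt)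
    refine (congrArg (fun L => L u) h1.mfderiv).trans ?_
    exact congrArg (mfderiv 𝓘(ℝ, ℂ) (𝓡 2) ψ.invFun (m (φ.toFun x)))
      (mul_comm (φ.pushforward x u) d)
  rw [hderiv, hderiv, φ.inner_eq]
  refine (ψ.metricInCoord_eq hmz _ _).trans ?_
  have hinner (a b : ℂ) : inner ℝ (d * a) (d * b) = ‖d‖ ^ 2 * inner ℝ a b := by
    simp only [Complex.inner, Complex.sq_norm, Complex.normSq_apply, map_mul, Complex.mul_re,
      Complex.mul_im, Complex.conj_re, Complex.conj_im]
    ring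
  -- Substituting 1 - |m z|² = |d| (1 - |z|²) cancels the hyperbolic weights and leaves the
  -- Euclidean factor of `φ` as |d|² times that of `ψ`, exactly the scaling of the inner product by
  -- `d`.
  have hfac := heq _ hz
  rw [Uniformization.conformalFactor, Uniformization.conformalFactor, ← hdn, mul_pow,
    mul_comm (‖d‖ ^ 2), mul_assoc] at hfac
  have hfac' := mul_left_cancel₀ (pow_ne_zero 2 (one_sub_norm_sq_pos hz).ne') hfac
  rw [hinner, hfac']
  ring

end

theorem mainTheorem2 {M N : Type*}
    [TopologicalSpace M] [ChartedSpace (EuclideanSpace ℝ (Fin 2)) M] [IsManifold (𝓡 2) ∞ M]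
    [TopologicalSpace N] [ChartedSpace (EuclideanSpace ℝ (Fin 2)) N] [IsManifold (𝓡 2) ∞ N]
    (g : SurfaceMetric M) (h : SurfaceMetric N)
    (φ : Uniformization g) (ψ : Uniformization h)
    (hM : φ.area = 1) (hN : ψ.area = 1)
    (ϱ : ℝ) (hϱ : 0 < ϱ)
    (hMfit : IsSinglyFittable g ϱ) (hNfit : IsSinglyFittable h ϱ)
    (R : ℝ) (hR : ϱ < R)
    (hzero : conformalWassersteinDist R φ ψ = 0) :
    ∃ m ∈ diskMobius,
      (∀ z ∈ unitDisk, φ.conformalFactor z = ψ.conformalFactor (m z)) ∧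
      ∃ F : M ≃ₘ^∞⟮𝓡 2, 𝓡 2⟯ N,
        (∀ x : M, ψ.toFun (F x) = m (φ.toFun x)) ∧ IsMetricPreserving g h F := by
  -- Fittability is used at radius `r`, local matching at `r'`; the gap between them allows
  -- neighbouring centres to be compared, and the gap up to `R` is the loss in
  -- `exists_eqOn_hypDisk`.
  obtain ⟨r, hϱr, hrR⟩ := exists_between hR
  obtain ⟨r', hrr', hr'R⟩ := exists_between hrR
  obtain ⟨m, hm, heq⟩ := exists_eqOn_unitDisk (μ := φ.conformalFactor) (ν := ψ.conformalFactor)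
    (hϱ.trans hϱr) hrr'
    (fun z hz => exists_eqOn_hypDisk φ.continuousOn_conformalFactor ψ.continuousOn_conformalFactor
      (fun _ hz => φ.conformalFactor_pos hz) (by simp [ψ.densityMeasure_univ, hN]) hr'R hzero hz)
    (fun z hz m hm heq => hNfit ψ r hϱr z hz m hm
      (patchDiscrepancy_eq_zero hz heq))
  obtain ⟨F, hF⟩ := exists_diffeomorph φ ψ hm
  refine ⟨m, hm, heq, F, fun x => ?_, ?_⟩
  · rw [hF, ψ.right_inv _ (mapsTo_of_mem_diskMobius hm (φ.mem_unitDisk x))]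
  · have hF' : (F : M → N) = fun x => ψ.invFun (m (φ.toFun x)) := funext hF
    rw [hF']
    exact isMetricPreserving_transfer φ ψ hm heq
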